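/- Fix integers $M,q\ge 1$, constants $c,C$ with $c>0$, and constants $c_1^*,\dots,c_M^*>0$. For positive integers $p_1,\dots,p_M$ put $p=\prod_m p_m$ and $p_{-m}=\prod_{j\ne m}p_j$. Consider the tensor $t$-regression model $$\mathbf Y_i=\mathbf B\,\bar\times_{M+1}\mathbf X_i+\mathbf E_i,\qquad \mathbf E_i\ \text{i.i.d.}\ \mathrm{TT}(0,\boldsymbol\Xi,\nu),\qquad i=1,\dots,n,$$ where $\mathbf B\in\mathbb R^{p_1\times\cdots\times p_M\times q}$, $\boldsymbol\Xi=\{\boldsymbol\Sigma_1,\dots,\boldsymbol\Sigma_M\}$ with $\boldsymbol\Sigma_m\in\mathbb R^{p_m\times p_m}$ symmetric positive definite, and $(\mathbf B\bar\times_{M+1}x)_{i_1\cdots i_M}=\sum_{k=1}^q b_{i_1\cdots i_Mk}x_k$. For $0<\nu<\infty$ the tensor $t$-distribution $\mathrm{TT}(\boldsymbol\mu,\boldsymbol\Xi,\nu)$ has the density $$\frac{\Gamma(\frac{\nu+p}2)\prod_{m=1}^M|\boldsymbol\Sigma_m|^{-p_{-m}/2}}{(\pi\nu)^{p/2}\,\Gamma(\nu/2)}\Big(1+\|\mathbf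 Y-\boldsymbol\mu\|_{\boldsymbol\Xi}^2/\nu\Big)^{-\frac{\nu+p}2},\qquad \|\mathbf A\|_{\boldsymbol\Xi}^2=\mathrm{vec}(\mathbf A)^T\big(\boldsymbol\Sigma_M^{-1}\otimes\cdots\otimes\boldsymbol\Sigma_1^{-1}\big)\mathrm{vec}(\mathbf A),$$ and $\mathrm{TT}(\boldsymbol\mu,\boldsymbol\Xi,\infty)$ is the tensor normal distribution, i.e. the law of $\boldsymbol\mu+\mathbf Z\times_1\boldsymbol\Sigma_1^{1/2}\times_2\cdots\times_M\boldsymbol\Sigma_M^{1/2}$ with $\mathbf Z$ having independent standard normal entries. For $\boldsymbol\Theta=(\mathbf B,\boldsymbol\Sigma_1,\dots,\boldsymbol\Sigma_M,\nu)$ let $\mathcal P=\mathcal P(s,p_m,c_m^*,m=1,\dots,M)$ be the set of all $\boldsymbol\Theta$ such that $\mathbf B$ has at most $s$ non-zero elements, each $\boldsymbol\Sigma_m$ is symmetric positive definite with smallest eigenvalue at least $c_m^*$, and $\nu\in(4,\infty]$. Let $\mathcal P_{\mathrm{id}}\subset\mathcal P$ be the subset of those $\boldsymbol\Theta$ for which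 the first element of $\boldsymbol\Sigma_m$ equals $1$ for $m=1,\dots,M-1$ (the constraint that makes $\boldsymbol\Xi$ identifiable). Write $\|\mathbf A\|_k=(\sum_j|a_j|^k)^{1/k}$ and $$\phi_1(n,p,s)=\sqrt{s\log(ep/s)/n},\qquad \phi_2(n,p,s)=s\sqrt{\log(ep/s)/n}.$$ Then there exists a constant $\bar c>0$, depending only on $M,q,c,C,c_1^*,\dots,c_M^*$, such that for all $n\ge 1$, all $p_1,\dots,p_M\ge1$, all integers $s$ with $1\le s\le ep$, and every fixed design $\mathbb X\in\mathbb R^{n\times q}$ with rows $\mathbf X_i^T$ for which all eigenvalues of $\mathbb X^T\mathbb X/n$ are at least $c$ and $\|\mathbf X_i\|_2\le C$ for all $i$, $$\inf_{\widehat{\mathbf B}}\sup_{\boldsymbol\Theta\in\mathcal P}\mathbb P_{\boldsymbol\Theta}\big(\|\widehat{\mathbf B}-\mathbf B\|_1\ge\phi_2(n,p,s)\big)\ge\bar c,\qquad \inf_{\widehat{\mathbf B}}\sup_{\boldsymbol\Theta\in\mathcal P}\mathbb P_{\boldsymbol\Theta}\big(\|\widehat{\mathbf B}-\mathbf B\|_2\ge\phi_1(n,p,s)\big)\ge\bar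 c,$$ where the infima are over all estimators, i.e. all measurable functions $\widehat{\mathbf B}$ of the data $(\mathbf Y_1,\dots,\mathbf Y_n)$ (which may depend on all the known quantities, including $\mathbb X$). If moreover $c_m^*\le1$ for $m=1,\dots,M-1$, then both inequalities also hold, with the same $\bar c$, when $\mathcal P$ is replaced by $\mathcal P_{\mathrm{id}}$. -/

import Mathlib

namespace TensorReg

open MeasureTheory ProbabilityTheory
open scoped ENNReal MatrixOrder

/-- Multi-indices `(i_1, …, i_M)` of a tensor of dimension `p_1 × ⋯ × p_M`. -/
abbrev Idx {M : ℕ} (p : Fin M → ℕ) : Type := (m : Fin M) → Fin (p m)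

/-- Tensors in `ℝ^{p_1 × ⋯ × p_M}`. -/
abbrev Tensor {M : ℕ} (p : Fin M → ℕ) : Type := Idx p → ℝ

/-- Coefficient tensors in `ℝ^{p_1 × ⋯ × p_M × q}`. -/
abbrev CoefTensor {M : ℕ} (p : Fin M → ℕ) (q : ℕ) : Type := Idx p × Fin q → ℝ

/-- Families of matrices `Σ_m ∈ ℝ^{p_m × p_m}`, `m = 1, …, M`. -/
abbrev MatFamily {M : ℕ} (p : Fin M → ℕ) : Type :=
  (m : Fin M) → Matrix (Fin (p m)) (Fin (p m)) ℝ

section Definitions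

variable {M : ℕ} {p : Fin M → ℕ} {q n : ℕ}

/-- The total dimension `p = ∏_m p_m`. -/
def totalDim (p : Fin M → ℕ) : ℕ := ∏ m, p m

/-- `p_{-m} = ∏_{j ≠ m} p_j`. -/
def coDim (p : Fin M → ℕ) (m : Fin M) : ℕ := ∏ j ∈ Finset.univ.erase m, p j

/-- The Tucker product `⟦A; G_1, …, G_M⟧` with square factor matrices. -/
def tucker (A : Tensor p) (G : MatFamily p) : Tensor p :=
  fun i => ∑ j : Idx p, (∏ m, G m (i m) (j m)) * A j

/-- The inner product `⟨A, B⟩ = vec(A)ᵀ vec(B)`. -/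
def tensorInner (A B : Tensor p) : ℝ := ∑ i, A i * B i

/-- The squared tensor Mahalanobis norm `‖A‖_Ξ² = ⟨⟦A; Σ_1⁻¹, …, Σ_M⁻¹⟧, A⟩`. -/
noncomputable def mahalanobisSq (S : MatFamily p) (A : Tensor p) : ℝ :=
  tensorInner (tucker A (fun m => (S m)⁻¹)) A

/-- The mode-`(M+1)` vector product `B ×̄_{M+1} x`. -/
def vecProd (B : CoefTensor p q) (x : Fin q → ℝ) : Tensor p :=
  fun i => ∑ k, B (i, k) * x k

/-- The tensor normal distribution `TN(μ, Ξ)`: the law of `μ + ⟦Z; Σ_1^{1/2}, …, Σ_M^{1/2}⟧`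
where `Z` has independent standard normal entries. -/
noncomputable def tensorNormal (μ : Tensor p) (S : MatFamily p) : Measure (Tensor p) :=
  (Measure.pi fun _ : Idx p => gaussianReal 0 1).map
    fun Z => μ + tucker Z fun m => CFC.sqrt (S m)

/-- The density of the tensor t-distribution `TT(μ, Ξ, ν)`. -/
noncomputable def tensorTDensity (μ : Tensor p) (S : MatFamily p) (ν : ℝ) (Y : Tensor p) : ℝ :=
  Real.Gamma ((ν + totalDim p) / 2) * (∏ m, (S m).det ^ (-(coDim p m : ℝ) / 2)) /
      ((Real.pi * ν) ^ ((totalDim p : ℝ) / 2) * Real.Gamma (ν / 2)) *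
    (1 + mahalanobisSq S (Y - μ) / ν) ^ (-(ν + totalDim p) / 2)

/-- The tensor t-distribution `TT(μ, Ξ, ν)` with degrees of freedom `ν ∈ (0, ∞]`;
`TT(μ, Ξ, ∞)` is the tensor normal distribution `TN(μ, Ξ)`. -/
noncomputable def tensorT (μ : Tensor p) (S : MatFamily p) (ν : ℝ≥0∞) : Measure (Tensor p) :=
  if ν = ⊤ then tensorNormal μ S
  else volume.withDensity fun Y => ENNReal.ofReal (tensorTDensity μ S ν.toReal Y)

/-- A parameter `Θ = (B, Σ_1, …, Σ_M, ν)` of the tensor t-regression model. -/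
structure Param {M : ℕ} (p : Fin M → ℕ) (q : ℕ) where
  B : CoefTensor p q
  S : MatFamily p
  ν : ℝ≥0∞

/-- The joint law of `(Y_1, …, Y_n)` in the tensor t-regression model
`Y_i = B ×̄_{M+1} X_i + E_i`, with `E_1, …, E_n` i.i.d. `TT(0, Ξ, ν)`;
the `i`-th row of `X` is the fixed covariate vector `X_i`. -/
noncomputable def dataLaw (X : Matrix (Fin n) (Fin q) ℝ) (Θ : Param p q) :
    Measure (Fin n → Tensor p) :=
  (Measure.pi fun _ : Fin n => tensorT 0 Θ.S Θ.ν).map fun E i => vecProd Θ.B (X i) + E i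

/-- The fixed design satisfies: the eigenvalues of the `q × q` matrix `XᵀX / n` are at least `c`,
and `‖X_i‖₂ ≤ C` for all `i`. -/
def DesignCondition (X : Matrix (Fin n) (Fin q) ℝ) (c C : ℝ) : Prop :=
  (∀ l ∈ spectrum ℝ ((n : ℝ)⁻¹ • (X.transpose * X)), c ≤ l) ∧
    ∀ i, ‖WithLp.toLp 2 (X i)‖ ≤ C

/-- The coefficient tensors with at most `s` non-zero elements. -/
def sparseSet (p : Fin M → ℕ) (q s : ℕ) : Set (CoefTensor p q) :=
  {A | {j | A j ≠ 0}.ncard ≤ s}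

/-- The symmetric positive definite `d × d` matrices with smallest eigenvalue at least `c`. -/
def wellCond (d : ℕ) (c : ℝ) : Set (Matrix (Fin d) (Fin d) ℝ) :=
  {A | A.PosDef ∧ ∀ l ∈ spectrum ℝ A, c ≤ l}

/-- The parameter space `𝒫(s, p_m, c_m^*, m = 1, …, M)`. -/
def paramSpace (p : Fin M → ℕ) (q s : ℕ) (cstar : Fin M → ℝ) : Set (Param p q) :=
  {Θ | Θ.B ∈ sparseSet p q s ∧ (∀ m, Θ.S m ∈ wellCond (p m) (cstar m)) ∧ Θ.ν ∈ Set.Ioc 4 ⊤}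

/-- The parameters that satisfy the identification constraint: the first element of `Σ_m` is one
for `m = 1, …, M - 1`. -/
def identified (p : Fin M → ℕ) (q : ℕ) : Set (Param p q) :=
  {Θ | ∀ m : Fin M, (m : ℕ) + 1 < M → ∀ i : Fin (p m), (i : ℕ) = 0 → Θ.S m i i = 1}

/-- The tensor `k`-norm `(∑_j |a_j|^k)^{1/k}`. -/
noncomputable def tensorNorm (k : ℝ) (A : CoefTensor p q) : ℝ :=
  (∑ j, |A j| ^ k) ^ (1 / k)

/-- `inf_{B̂} sup_{Θ ∈ 𝒫} ℙ_Θ(‖B̂ - B‖_k ≥ φ)`, where the infimum is over all estimators, i.e.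
all measurable functions of the data. -/
noncomputable def minimaxProb (X : Matrix (Fin n) (Fin q) ℝ) (P : Set (Param p q)) (k φ : ℝ) :
    ℝ≥0∞ :=
  ⨅ Bhat : {f : (Fin n → Tensor p) → CoefTensor p q // Measurable f},
    ⨆ Θ ∈ P, dataLaw X Θ {Y | φ ≤ tensorNorm k (Bhat.1 Y - Θ.B)}

/-- `φ₁(n, p, s) = √(s log(ep/s) / n)`. -/
noncomputable def phi1 (n p s : ℕ) : ℝ :=
  √((s : ℝ) * Real.log (Real.exp 1 * p / s) / n)

/-- `φ₂(n, p, s) = s √(log(ep/s) / n)`. -/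
noncomputable def phi2 (n p s : ℕ) : ℝ :=
  s * √(Real.log (Real.exp 1 * p / s) / n)

end Definitions

end TensorReg

/-!
For isotropic Gaussian noise of a fixed level (`ν = ∞`, `Σ_m = a_m I`), both lower bounds follow
from testing among many sparse coefficient tensors, in a second-moment variant of Fano's method.

The hypotheses. Let `t = min s p`, `l = log (e p / t)` and `h` of order `√(l / n)`. Split the cells
of a tensor into `t` blocks of about `p / t` cells; a word `u` of length `t` selects in each block a
cell and one of finitely many amplitudes, and `wordTensor` puts the corresponding multiple of `h`
there, always for the same covariate. Two words that differ in more than `t / 2` letters give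
tensors at distance at least `2 φ₂` in the 1-norm and `2 φ₁` in the 2-norm. There are `Q ^ t`
words, where `Q` is of order `p / t`, and at most `2 ^ t * Q ^ (t / 2)` of them lie in a Hamming
ball of radius `t / 2` (`card_hammingBall_sq_le`).

The testing bound. Let `L_u` be the density of the law for the word `u` relative to the law for zero
coefficients; its second moment is `exp (‖shift‖²)`, computed for a Gaussian variable and
tensorized in `ShiftBound.pi`. If `A_u` is the event that the estimate lies within `φ` of the tensor
of `u`, then the words `u` whose `A_u` contains a given data point all lie in one Hamming ball, so
there are at most `V` of them, `V` being the size of the ball. Since `L ≤ T + L² / T`, the average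
over the words of `P_u(A_u)` is at most `T V / N + E L² / T`, where `N` is the number of words. When `N` dominates `V E L²`, a choice of `T` makes this less than `1/2`
(`exists_withDensity_le_half`), so some word has error probability at least `1/2`.

The second moment is at most `exp (t l / 2)` as soon as the noise variance exceeds a constant
that depends only on `C`, while `N / V` is at least `32 exp (t l / 2)`. The constant in the variance
is carried by the last mode, which the identification constraint leaves free (`noiseScale`), so the
same family serves both parameter spaces. The range `p < s ≤ e p` reduces to `s = p` because there
both rates are bounded by multiples of their values at `s = p` (`rate_le_rate_min`).
-/

namespace TensorReg

open MeasureTheory ProbabilityTheory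
open scoped ENNReal MatrixOrder

/-! ### Translates of product measures -/

/-- The translate of `μ` by `v` has a density with respect to `μ` whose second moment is at most
`exp D`; equivalently, `1 + χ²` of the translate relative to `μ` is at most `exp D`. -/
def ShiftBound {E : Type*} [MeasurableSpace E] [Add E] (μ : Measure E) (v : E) (D : ℝ) : Prop :=
  ∃ g : E → ℝ≥0∞, Measurable g ∧ μ.map (fun x => v + x) = μ.withDensity g ∧
    ∫⁻ x, g x ^ 2 ∂μ ≤ ENNReal.ofReal (Real.exp D)

lemma shiftBound_gaussianReal (m : ℝ) : ShiftBound (gaussianReal 0 1) m (m ^ 2) := by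
  have hmeas : Measurable fun x : ℝ => ENNReal.ofReal (Real.exp (m * x - m ^ 2 / 2)) := by
    fun_prop
  refine ⟨_, hmeas, ?_, ?_⟩
  · rw [gaussianReal_map_const_add, zero_add, gaussianReal_of_var_ne_zero _ one_ne_zero,
      gaussianReal_of_var_ne_zero _ one_ne_zero, ← withDensity_mul _ (by fun_prop) hmeas]
    congr 1
    ext x
    simp only [Pi.mul_apply, gaussianPDF, gaussianPDFReal]
    rw [← ENNReal.ofReal_mul (by positivity), mul_assoc (√_)⁻¹, ← Real.exp_add]
    congr 3
    simp
    ring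
  · have hint : Integrable (fun x : ℝ => Real.exp (2 * m * x)) (gaussianReal 0 1) :=
      integrable_exp_mul_gaussianReal _
    have hmgf : ∫ x, Real.exp (2 * m * x) ∂(gaussianReal 0 1) = Real.exp (2 * m ^ 2) := by
      have := congrFun (mgf_id_gaussianReal (μ := 0) (v := 1)) (2 * m)
      simp only [mgf, id] at this
      rw [this]
      congr 1
      simp
      ring
    have hsq : ∀ x : ℝ, ENNReal.ofReal (Real.exp (m * x - m ^ 2 / 2)) ^ 2 =
        ENNReal.ofReal (Real.exp (2 * m * x) * Real.exp (-m ^ 2)) := by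
      intro x
      rw [← ENNReal.ofReal_pow (Real.exp_nonneg _), ← Real.exp_nat_mul, ← Real.exp_add]
      congr 2
      push_cast
      ring
    simp_rw [hsq]
    rw [← ofReal_integral_eq_lintegral_ofReal (hint.mul_const _)
      (Filter.Eventually.of_forall fun x => by positivity), integral_mul_const, hmgf,
      ← Real.exp_add]
    apply le_of_eq
    congr 2
    ring

section Pi

variable {ι : Type*} [Fintype ι] {E : ι → Type*} [∀ i, MeasurableSpace (E i)]

lemma lintegral_pi_prod (μ : ∀ i, Measure (E i)) [∀ i, IsProbabilityMeasure (μ i)]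
    {g : ∀ i, E i → ℝ≥0∞} (hg : ∀ i, Measurable (g i)) :
    ∫⁻ x, ∏ i, g i (x i) ∂(Measure.pi μ) = ∏ i, ∫⁻ x, g i x ∂(μ i) := by
  refine (lintegral_prod_eq_prod_lintegral_of_indepFun (μ := Measure.pi μ)
    Finset.univ (fun i (x : ∀ i, E i) => g i (x i)) (iIndepFun_pi fun i => (hg i).aemeasurable)
    (fun i => (hg i).comp (measurable_pi_apply i))).trans ?_
  refine Finset.prod_congr rfl fun i _ => ?_
  rw [← lintegral_map (hg i) (measurable_pi_apply i)]
  exact congrArg (fun ν => ∫⁻ x, g i x ∂ν) (measurePreserving_eval μ i).map_eq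

lemma pi_withDensity (μ : ∀ i, Measure (E i)) [∀ i, IsProbabilityMeasure (μ i)]
    {g : ∀ i, E i → ℝ≥0∞} (hg : ∀ i, Measurable (g i))
    [∀ i, SigmaFinite ((μ i).withDensity (g i))] :
    Measure.pi (fun i => (μ i).withDensity (g i)) =
      (Measure.pi μ).withDensity fun x => ∏ i, g i (x i) := by
  refine Measure.pi_eq fun s hs => ?_
  rw [withDensity_apply _ (.univ_pi hs), ← lintegral_indicator (.univ_pi hs)]
  have : ∀ x : ∀ i, E i, (Set.univ.pi s).indicator (fun x => ∏ i, g i (x i)) x =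
      ∏ i, (s i).indicator (g i) (x i) := by
    intro x
    by_cases hx : x ∈ Set.univ.pi s
    · rw [Set.indicator_of_mem hx]
      exact Finset.prod_congr rfl fun i _ => by
        rw [Set.indicator_of_mem (hx i (Set.mem_univ i))]
    · rw [Set.indicator_of_notMem hx]
      simp only [Set.mem_pi, Set.mem_univ, true_implies, not_forall] at hx
      obtain ⟨i, hi⟩ := hx
      exact (Finset.prod_eq_zero (Finset.mem_univ i) (Set.indicator_of_notMem hi _)).symm
  simp_rw [this]
  rw [lintegral_pi_prod μ fun i => (hg i).indicator (hs i)]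
  refine Finset.prod_congr rfl fun i _ => ?_
  rw [lintegral_indicator (hs i), withDensity_apply _ (hs i)]

lemma ShiftBound.pi [∀ i, Add (E i)] [∀ i, MeasurableAdd (E i)] (μ : ∀ i, Measure (E i))
    [∀ i, IsProbabilityMeasure (μ i)] {v : ∀ i, E i} {D : ι → ℝ}
    (h : ∀ i, ShiftBound (μ i) (v i) (D i)) :
    ShiftBound (Measure.pi μ) v (∑ i, D i) := by
  choose g hg hmap hsq using h
  have hprob : ∀ i, IsProbabilityMeasure ((μ i).map fun x => v i + x) := fun i =>
    Measure.isProbabilityMeasure_map (measurable_const_add (v i)).aemeasurable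
  have hprob' : ∀ i, IsProbabilityMeasure ((μ i).withDensity (g i)) := fun i => hmap i ▸ hprob i
  refine ⟨fun x => ∏ i, g i (x i), ?_, ?_, ?_⟩
  · exact Finset.measurable_fun_prod _ fun i _ => (hg i).comp (measurable_pi_apply i)
  · rw [← pi_withDensity μ hg]
    have := Measure.pi_map_pi (μ := μ) (f := fun i x => v i + x)
      fun i => (measurable_const_add (v i)).aemeasurable
    simp_rw [hmap] at this
    exact this
  · simp_rw [← Finset.prod_pow]
    rw [lintegral_pi_prod μ fun i => (hg i).pow_const 2, Real.exp_sum,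
      ENNReal.ofReal_prod_of_nonneg fun i _ => Real.exp_nonneg _]
    exact Finset.prod_le_prod' fun i _ => hsq i

end Pi

/-! ### A second-moment version of Fano's inequality -/

lemma withDensity_apply_le {Ω : Type*} [MeasurableSpace Ω] (μ : Measure Ω) {g : Ω → ℝ≥0∞}
    {A : Set Ω} (hA : MeasurableSet A) {T D : ℝ≥0∞} (hT : T ≠ 0)
    (hT' : T ≠ ⊤) (hD : ∫⁻ x, g x ^ 2 ∂μ ≤ D) :
    μ.withDensity g A ≤ T * μ A + T⁻¹ * D := by
  have hpt : ∀ x, g x ≤ T + T⁻¹ * g x ^ 2 := by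
    intro x
    rcases le_total (g x) T with h | h
    · exact h.trans le_self_add
    · calc g x = T⁻¹ * T * g x := by rw [ENNReal.inv_mul_cancel hT hT', one_mul]
        _ ≤ T⁻¹ * g x * g x := by gcongr
        _ = T⁻¹ * g x ^ 2 := by ring
        _ ≤ _ := le_add_self
  rw [withDensity_apply _ hA]
  calc ∫⁻ x in A, g x ∂μ ≤ ∫⁻ x in A, (T + T⁻¹ * g x ^ 2) ∂μ := lintegral_mono hpt
    _ = T * μ A + T⁻¹ * ∫⁻ x in A, g x ^ 2 ∂μ := by
        rw [lintegral_add_left measurable_const, setLIntegral_const,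
          lintegral_const_mul' _ _ (ENNReal.inv_ne_top.2 hT)]
    _ ≤ _ := by
        gcongr
        exact (setLIntegral_le_lintegral _ _).trans hD

/-- If every point lies in at most `V` of the sets `A u` and the family of densities `g u` is much
larger than `V` times their common second-moment bound, then some `A u` is not likely under its own
law `g u · μ`. -/
lemma exists_withDensity_le_half {Ω ι : Type*} [MeasurableSpace Ω] [Fintype ι] [Nonempty ι]
    (μ : Measure Ω) [IsProbabilityMeasure μ] {g : ι → Ω → ℝ≥0∞}
    {d V : ℝ} (hD : ∀ u, ∫⁻ x, g u x ^ 2 ∂μ ≤ ENNReal.ofReal (Real.exp d)) {A : ι → Set Ω}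
    (hA : ∀ u, MeasurableSet (A u)) (hV : ∀ ω, ({u | ω ∈ A u}.ncard : ℝ) ≤ V)
    (hN : 32 * Real.exp d * V ≤ Fintype.card ι) :
    ∃ u, μ.withDensity (g u) (A u) ≤ 1 / 2 := by
  classical
  by_contra! hcon
  set N : ℝ := (Fintype.card ι : ℝ) with hNdef
  have hNpos : 0 < N := by simpa [hNdef] using (Fintype.card_pos (α := ι))
  have hV0 : 0 ≤ V := by
    obtain ⟨ω⟩ := μ.nonempty_of_neZero
    exact (Nat.cast_nonneg _).trans (hV ω)
  have hsum : ∑ u, μ (A u) ≤ ENNReal.ofReal V := by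
    calc ∑ u, μ (A u) = ∫⁻ ω, ∑ u, (A u).indicator 1 ω ∂μ := by
          rw [lintegral_finsetSum _ fun u _ => measurable_one.indicator (hA u)]
          exact Finset.sum_congr rfl fun u _ => (lintegral_indicator_one (hA u)).symm
      _ ≤ ∫⁻ _, ENNReal.ofReal V ∂μ := by
          refine lintegral_mono fun ω => ?_
          have : ∑ u, (A u).indicator (1 : Ω → ℝ≥0∞) ω = (({u | ω ∈ A u}.ncard : ℕ) : ℝ≥0∞) := by
            simp only [Set.indicator_apply, Pi.one_apply, Finset.sum_boole]
            congr 1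
            rw [← Set.ncard_coe_finset]
            simp
          rw [this, ← ENNReal.ofReal_natCast]
          exact ENNReal.ofReal_le_ofReal (hV ω)
      _ = ENNReal.ofReal V := by simp
  -- Truncating the densities at four times the second-moment bound.
  set T : ℝ := 4 * Real.exp d with hTdef
  have hTpos : 0 < T := by positivity
  have hbound : ∀ u, μ.withDensity (g u) (A u) ≤
      ENNReal.ofReal T * μ (A u) + ENNReal.ofReal (1 / 4) := by
    intro u
    refine (withDensity_apply_le μ (hA u) (ENNReal.ofReal_pos.2 hTpos).ne'
      ENNReal.ofReal_ne_top (hD u)).trans (le_of_eq ?_)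
    rw [← ENNReal.ofReal_inv_of_pos hTpos, ← ENNReal.ofReal_mul (by positivity)]
    congr 2
    rw [hTdef]
    field_simp
  have htot : ∑ _u : ι, (1 / 2 : ℝ≥0∞) ≤ ENNReal.ofReal (T * V + N * (1 / 4)) := by
    calc ∑ _u : ι, (1 / 2 : ℝ≥0∞) ≤ ∑ u, (ENNReal.ofReal T * μ (A u) + ENNReal.ofReal (1 / 4)) :=
          Finset.sum_le_sum fun u _ => (hcon u).le.trans (hbound u)
      _ = ENNReal.ofReal T * ∑ u, μ (A u) + ENNReal.ofReal (N * (1 / 4)) := by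
          rw [Finset.sum_add_distrib, ← Finset.mul_sum, Finset.sum_const, nsmul_eq_mul,
            Finset.card_univ, ENNReal.ofReal_mul hNpos.le, hNdef, ENNReal.ofReal_natCast]
      _ ≤ ENNReal.ofReal T * ENNReal.ofReal V + ENNReal.ofReal (N * (1 / 4)) := by gcongr
      _ = _ := by
          rw [← ENNReal.ofReal_mul hTpos.le, ← ENNReal.ofReal_add (by positivity) (by positivity)]
  have hhalf : ∑ _u : ι, (1 / 2 : ℝ≥0∞) = ENNReal.ofReal (N * (1 / 2)) := by
    rw [Finset.sum_const, nsmul_eq_mul, Finset.card_univ, ENNReal.ofReal_mul hNpos.le, hNdef,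
      ENNReal.ofReal_natCast, ENNReal.ofReal_div_of_pos two_pos]
    simp
  rw [hhalf, ENNReal.ofReal_le_ofReal_iff (by positivity)] at htot
  rw [hTdef] at htot
  nlinarith

/-! ### Volume of Hamming balls -/

/-- The bound is a Chernoff bound: every word within distance `s / 2` of `u₀` has weight at least
one under the product weight that charges `√Q` for agreement and `1 / √Q` for disagreement,
`Q` being the size of the alphabet. -/
lemma card_hammingBall_sq_le {α : Type*} [Fintype α] [DecidableEq α] [Nonempty α] (s : ℕ)
    (u₀ : Fin s → α) :
    ((Finset.univ.filter fun u : Fin s → α => 2 * hammingDist u u₀ ≤ s).card : ℝ) ^ 2 ≤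
      4 ^ s * (Fintype.card α : ℝ) ^ s := by
  set Q : ℝ := (Fintype.card α : ℝ) with hQ
  have hQ1 : 1 ≤ Q := by
    rw [hQ]; exact_mod_cast Fintype.card_pos
  have hQ0 : 0 < Q := by linarith
  set r : ℝ := √Q with hr
  have hr1 : 1 ≤ r := Real.one_le_sqrt.2 hQ1
  have hrQ : r ^ 2 = Q := Real.sq_sqrt hQ0.le
  have hmain : ((Finset.univ.filter fun u : Fin s → α => 2 * hammingDist u u₀ ≤ s).card : ℝ) ≤
      r ^ s * 2 ^ s := by
    calc ((Finset.univ.filter fun u : Fin s → α => 2 * hammingDist u u₀ ≤ s).card : ℝ)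
        = ∑ u : Fin s → α, if 2 * hammingDist u u₀ ≤ s then (1 : ℝ) else 0 := by
          rw [Finset.sum_boole]
      _ ≤ ∑ u : Fin s → α, r ^ s * ∏ i, if u i = u₀ i then 1 else Q⁻¹ := by
          refine Finset.sum_le_sum fun u _ => ?_
          have hprod : (∏ i, if u i = u₀ i then 1 else Q⁻¹) = Q⁻¹ ^ hammingDist u u₀ := by
            rw [Finset.prod_ite, Finset.prod_const_one, one_mul, Finset.prod_const]
            rfl
          rw [hprod]
          split_ifs with h
          · rw [inv_pow, ← div_eq_mul_inv, one_le_div (by positivity), ← hrQ, ← pow_mul]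
            exact pow_le_pow_right₀ hr1 h
          · positivity
      _ = r ^ s * ∏ i : Fin s, ∑ a : α, if a = u₀ i then 1 else Q⁻¹ := by
          rw [← Finset.mul_sum, Fintype.prod_sum]
      _ ≤ r ^ s * ∏ _i : Fin s, (2 : ℝ) := by
          gcongr with i
          calc (∑ a : α, if a = u₀ i then 1 else Q⁻¹)
              ≤ ∑ a : α, ((if a = u₀ i then 1 else 0) + Q⁻¹) := by
                refine Finset.sum_le_sum fun a _ => ?_
                split_ifs
                · linarith [inv_pos.2 hQ0]
                · linarith
            _ = 2 := by
                rw [Finset.sum_add_distrib, Finset.sum_const, Finset.card_univ, nsmul_eq_mul,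
                  ← hQ, mul_inv_cancel₀ hQ0.ne']
                simp
                norm_num
      _ = r ^ s * 2 ^ s := by simp
  calc _ ≤ (r ^ s * 2 ^ s) ^ 2 := by gcongr
    _ = 4 ^ s * Q ^ s := by
        rw [← hrQ, show (4 : ℝ) = 2 ^ 2 by norm_num, ← mul_pow, ← mul_pow, ← mul_pow, ← pow_mul,
          ← pow_mul, mul_comm s, pow_mul, pow_mul, mul_comm r]

variable {M : ℕ} {p : Fin M → ℕ} {q n : ℕ}

/-! ### The model with isotropic Gaussian noise -/

lemma sqrt_smul_one {d : ℕ} {a : ℝ} (ha : 0 ≤ a) :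
    CFC.sqrt (a • (1 : Matrix (Fin d) (Fin d) ℝ)) = √a • 1 := by
  have hnn : ∀ {b : ℝ}, 0 ≤ b → 0 ≤ b • (1 : Matrix (Fin d) (Fin d) ℝ) := fun hb =>
    Matrix.nonneg_iff_posSemidef.2 (Matrix.PosSemidef.one.smul hb)
  refine CFC.sqrt_unique ?_ (hnn (Real.sqrt_nonneg a))
  rw [smul_mul_smul_comm, one_mul, Real.mul_self_sqrt ha]

lemma smul_one_mem_wellCond {d : ℕ} {a c : ℝ} (ha : 0 < a) (hca : c ≤ a) :
    a • (1 : Matrix (Fin d) (Fin d) ℝ) ∈ wellCond d c := by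
  refine ⟨Matrix.PosDef.one.smul ha, fun l hl => ?_⟩
  rcases subsingleton_or_nontrivial (Matrix (Fin d) (Fin d) ℝ) with h | h
  · simp [spectrum.of_subsingleton] at hl
  · rw [← Algebra.algebraMap_eq_smul_one, spectrum.scalar_eq] at hl
    rw [Set.mem_singleton_iff.1 hl]
    exact hca

lemma tucker_smul_one (Z : Tensor p) (r : Fin M → ℝ) :
    tucker Z (fun m => r m • 1) = (∏ m, r m) • Z := by
  ext i
  have h : ∀ j : Idx p, ∏ m, (r m • (1 : Matrix (Fin (p m)) (Fin (p m)) ℝ)) (i m) (j m) =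
      if i = j then ∏ m, r m else 0 := by
    intro j
    simp only [Matrix.smul_apply, Matrix.one_apply, smul_eq_mul, mul_ite, mul_one, mul_zero]
    rw [Finset.prod_ite_zero]
    simp [funext_iff]
  simp only [tucker, h]
  simp

/-- The law of the `n` independent standard normal tensors that drive the noise. -/
noncomputable def stdNoise (n : ℕ) (p : Fin M → ℕ) : Measure (Fin n → Tensor p) :=
  Measure.pi fun _ : Fin n => Measure.pi fun _ : Idx p => gaussianReal 0 1

instance : IsProbabilityMeasure (stdNoise n p) := by
  unfold stdNoise; infer_instance

lemma shiftBound_stdNoise (v : Fin n → Tensor p) :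
    ShiftBound (stdNoise n p) v (∑ i, ∑ j, v i j ^ 2) :=
  ShiftBound.pi _ fun i => ShiftBound.pi _ fun j => shiftBound_gaussianReal (v i j)

/-- With `Σ_m = a_m I`, the data are a dilation of translated standard noise. -/
lemma dataLaw_scalar (X : Matrix (Fin n) (Fin q) ℝ) (B : CoefTensor p q) {a : Fin M → ℝ}
    (ha : ∀ m, 0 < a m) :
    dataLaw X ⟨B, fun m => a m • 1, ⊤⟩ =
      ((stdNoise n p).map fun Z => (fun i => (∏ m, √(a m))⁻¹ • vecProd B (X i)) + Z).map
        fun Y => (∏ m, √(a m)) • Y := by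
  set σ : ℝ := ∏ m, √(a m) with hσ
  have hσ0 : σ ≠ 0 := (Finset.prod_pos fun m _ => Real.sqrt_pos.2 (ha m)).ne'
  have hnoise : tensorT (0 : Tensor p) (fun m => a m • 1) ⊤ =
      (Measure.pi fun _ : Idx p => gaussianReal 0 1).map fun Z => σ • Z := by
    simp only [tensorT, if_pos, tensorNormal, sqrt_smul_one (ha _).le, tucker_smul_one, zero_add,
      ← hσ]
  have hmeas : Measurable fun Z : Tensor p => σ • Z := measurable_const_smul σ
  have hprob : IsProbabilityMeasure
      ((Measure.pi fun _ : Idx p => gaussianReal 0 1).map fun Z => σ • Z) :=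
    Measure.isProbabilityMeasure_map hmeas.aemeasurable
  rw [dataLaw]
  simp only [hnoise]
  rw [← Measure.pi_map_pi fun _ => hmeas.aemeasurable, Measure.map_map (by fun_prop) (by fun_prop),
    Measure.map_map (by fun_prop) (by fun_prop)]
  unfold stdNoise
  congr 1
  ext Z i j
  simp only [Function.comp_apply, Pi.smul_apply, Pi.add_apply, smul_eq_mul]
  rw [mul_add, mul_inv_cancel_left₀ hσ0]

/-! ### The tensor norm -/

lemma tensorNorm_sub_le {k : ℝ} (hk : 1 ≤ k) (A B D : CoefTensor p q) :
    tensorNorm k (A - B) ≤ tensorNorm k (D - A) + tensorNorm k (D - B) := by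
  have := Real.Lp_add_le Finset.univ (fun j => A j - D j) (fun j => D j - B j) hk
  simp only [sub_add_sub_cancel] at this
  simpa [tensorNorm, abs_sub_comm (D _) (A _)] using this

lemma measurable_tensorNorm (k : ℝ) :
    Measurable (tensorNorm k : CoefTensor p q → ℝ) := by
  unfold tensorNorm
  refine Measurable.pow_const (Finset.measurable_fun_sum _ fun j _ => Measurable.pow_const ?_ k) _
  exact (measurable_pi_apply j).abs

/-! ### A family of sparse coefficient tensors indexed by words -/

section Words

variable {s b R : ℕ}

/-- The coefficient tensor of a word `u`: the cells `e (i, j)`, `j < b`, form the `i`-th of `s`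
disjoint blocks, and the letter `u i = (j, a)` places the entry `h (a + 1)` at cell `j` of block
`i`, for the covariate `k₀`; all other entries vanish. -/
noncomputable def wordTensor (e : Fin s × Fin b → Idx p) (k₀ : Fin q) (h : ℝ)
    (u : Fin s → Fin b × Fin R) : CoefTensor p q :=
  fun x => if x.2 = k₀ then
    ∑ i, if x.1 = e (i, (u i).1) then h * ((u i).2 + 1) else 0 else 0

variable {e : Fin s × Fin b → Idx p} (he : Function.Injective e) (k₀ : Fin q) (h : ℝ)

lemma wordTensor_eq_zero (u : Fin s → Fin b × Fin R) {x : Idx p × Fin q}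
    (hx : x ∉ Finset.univ.image fun i => (e (i, (u i).1), k₀)) :
    wordTensor e k₀ h u x = 0 := by
  obtain ⟨x, k⟩ := x
  simp only [wordTensor]
  split_ifs with hk
  · refine Finset.sum_eq_zero fun i _ => if_neg fun hxi => hx ?_
    exact Finset.mem_image.2 ⟨i, Finset.mem_univ i, Prod.ext hxi.symm hk.symm⟩
  · rfl

lemma wordTensor_mem_sparseSet {t : ℕ} (hst : s ≤ t) (u : Fin s → Fin b × Fin R) :
    wordTensor e k₀ h u ∈ sparseSet p q t := by
  have hsub : {x | wordTensor e k₀ h u x ≠ 0} ⊆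
      ((Finset.univ.image fun i => (e (i, (u i).1), k₀) : Finset _) : Set (Idx p × Fin q)) := by
    intro x hx
    by_contra hx'
    exact hx (wordTensor_eq_zero k₀ h u hx')
  calc _ ≤ (Finset.univ.image fun i => (e (i, (u i).1), k₀)).card := by
        rw [← Set.ncard_coe_finset]
        exact Set.ncard_le_ncard hsub (Finset.finite_toSet _)
    _ ≤ s := Finset.card_image_le.trans (by simp)
    _ ≤ t := hst

include he in
lemma wordTensor_apply (u : Fin s → Fin b × Fin R) (i : Fin s) (j : Fin b) :
    wordTensor e k₀ h u (e (i, j), k₀) = if j = (u i).1 then h * ((u i).2 + 1) else 0 := by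
  simp only [wordTensor, if_true, he.eq_iff, Prod.mk.injEq]
  rw [Finset.sum_eq_single i]
  · simp
  · intro i' _ hi'
    simp [hi'.symm]
  · simp

include he in
lemma sum_wordTensor_sq_le (u : Fin s → Fin b × Fin R) :
    ∑ x, wordTensor e k₀ h u (x, k₀) ^ 2 ≤ s * (h * R) ^ 2 := by
  have hinj : Function.Injective fun i => e (i, (u i).1) := fun i i' hii =>
    (Prod.mk.inj (he hii)).1
  calc ∑ x, wordTensor e k₀ h u (x, k₀) ^ 2
      = ∑ x ∈ Finset.univ.image fun i => e (i, (u i).1), wordTensor e k₀ h u (x, k₀) ^ 2 := by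
        symm
        refine Finset.sum_subset (Finset.subset_univ _) fun x _ hx => ?_
        rw [wordTensor_eq_zero, zero_pow two_ne_zero]
        intro hx'
        obtain ⟨i, hi, hix⟩ := Finset.mem_image.1 hx'
        exact hx (Finset.mem_image.2 ⟨i, hi, (Prod.mk.inj hix).1⟩)
    _ = ∑ i, wordTensor e k₀ h u (e (i, (u i).1), k₀) ^ 2 :=
        Finset.sum_image fun i _ i' _ hii => hinj hii
    _ ≤ ∑ _i : Fin s, (h * R) ^ 2 := by
        refine Finset.sum_le_sum fun i _ => ?_
        rw [wordTensor_apply he, if_pos rfl, mul_pow, mul_pow]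
        have : ((u i).2 : ℝ) + 1 ≤ R := by exact_mod_cast (u i).2.isLt
        gcongr
    _ = s * (h * R) ^ 2 := by simp

include he in
lemma hammingDist_le_sum_wordTensor {k : ℝ} (hk : 0 ≤ k) (hh : 0 ≤ h)
    (u u' : Fin s → Fin b × Fin R) :
    hammingDist u u' * h ^ k ≤
      ∑ x, |(wordTensor e k₀ h u - wordTensor e k₀ h u') x| ^ k := by
  have hinj : Function.Injective fun i => (e (i, (u i).1), k₀) := fun i i' hii =>
    (Prod.mk.inj (he (Prod.mk.inj hii).1)).1
  calc (hammingDist u u' : ℝ) * h ^ k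
      = ∑ _i ∈ Finset.univ.filter (fun i => u i ≠ u' i), h ^ k := by
        rw [Finset.sum_const, nsmul_eq_mul]; rfl
    _ ≤ ∑ i ∈ Finset.univ.filter (fun i => u i ≠ u' i),
          |(wordTensor e k₀ h u - wordTensor e k₀ h u') (e (i, (u i).1), k₀)| ^ k := by
        refine Finset.sum_le_sum fun i hi => Real.rpow_le_rpow hh ?_ hk
        have hi' := (Finset.mem_filter.1 hi).2
        rw [Pi.sub_apply, wordTensor_apply he, wordTensor_apply he, if_pos rfl]
        split_ifs with hpos
        · have hval : ((u i).2 : ℕ) ≠ (u' i).2 := fun hv => hi' (Prod.ext hpos (Fin.ext hv))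
          rw [← mul_sub, abs_mul, abs_of_nonneg hh]
          refine le_mul_of_one_le_right hh ?_
          have : (1 : ℤ) ≤ |((u i).2 : ℤ) - ((u' i).2 : ℤ)| :=
            Int.one_le_abs (sub_ne_zero.2 (by exact_mod_cast hval))
          rw [add_sub_add_right_eq_sub]
          exact_mod_cast this
        · rw [sub_zero, abs_of_nonneg (by positivity)]
          exact le_mul_of_one_le_right hh (by simp)
    _ = ∑ x ∈ (Finset.univ.filter fun i => u i ≠ u' i).image fun i => (e (i, (u i).1), k₀),
          |(wordTensor e k₀ h u - wordTensor e k₀ h u') x| ^ k :=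
        (Finset.sum_image (f := fun x =>
          |(wordTensor e k₀ h u - wordTensor e k₀ h u') x| ^ k) fun i _ i' _ hii => hinj hii).symm
    _ ≤ _ := Finset.sum_le_sum_of_subset_of_nonneg (Finset.subset_univ _)
        fun x _ _ => by positivity

lemma vecProd_wordTensor (u : Fin s → Fin b × Fin R) (x : Fin q → ℝ) (i : Idx p) :
    vecProd (wordTensor e k₀ h u) x i = wordTensor e k₀ h u (i, k₀) * x k₀ := by
  rw [vecProd, Finset.sum_eq_single k₀]
  · intro k _ hk
    simp [wordTensor, hk]
  · simp

/-- Two word tensors at tensor distance below `2 φ` come from words that agree on at least half of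
their letters. -/
lemma hammingDist_le_of_tensorNorm_lt {k φ : ℝ} (hk : 1 ≤ k) (hh : 0 ≤ h)
    (hsep : (2 * φ) ^ k ≤ s / 2 * h ^ k) (he : Function.Injective e)
    {u u' : Fin s → Fin b × Fin R}
    (hlt : tensorNorm k (wordTensor e k₀ h u - wordTensor e k₀ h u') < 2 * φ) :
    2 * hammingDist u u' ≤ s := by
  have hk0 : 0 < k := by linarith
  have h1 := hammingDist_le_sum_wordTensor he k₀ h hk0.le hh u u'
  set S := ∑ x, |(wordTensor e k₀ h u - wordTensor e k₀ h u') x| ^ k with hS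
  have hS0 : 0 ≤ S := Finset.sum_nonneg fun x _ => by positivity
  have h2 : S < (2 * φ) ^ k := by
    have := Real.rpow_lt_rpow (by unfold tensorNorm; positivity) hlt hk0
    rwa [tensorNorm, ← hS, ← Real.rpow_mul hS0, one_div, inv_mul_cancel₀ hk0.ne',
      Real.rpow_one] at this
  have h3 : (hammingDist u u' : ℝ) * h ^ k < s / 2 * h ^ k := by linarith
  have h4 : (hammingDist u u' : ℝ) < s / 2 := lt_of_mul_lt_mul_right h3 (by positivity)
  have h5 : (2 * hammingDist u u' : ℝ) ≤ s := by linarith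
  exact_mod_cast h5

end Words

/-! ### The minimax lower bound -/

lemma sum_sq_shift_le {s b R : ℕ} {e : Fin s × Fin b → Idx p} (he : Function.Injective e)
    {k₀ : Fin q} {h C σ : ℝ} {X : Matrix (Fin n) (Fin q) ℝ} (hX : ∀ i, X i k₀ ^ 2 ≤ C ^ 2)
    (u : Fin s → Fin b × Fin R) :
    ∑ i, ∑ j, ((σ⁻¹ • vecProd (wordTensor e k₀ h u) (X i)) j) ^ 2 ≤
      n * C ^ 2 * (s * (h * R) ^ 2) / σ ^ 2 := by
  have hrow : ∀ i, ∑ j, ((σ⁻¹ • vecProd (wordTensor e k₀ h u) (X i)) j) ^ 2 ≤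
      C ^ 2 * (s * (h * R) ^ 2) / σ ^ 2 := by
    intro i
    calc ∑ j, ((σ⁻¹ • vecProd (wordTensor e k₀ h u) (X i)) j) ^ 2
        = X i k₀ ^ 2 * (∑ j, wordTensor e k₀ h u (j, k₀) ^ 2) / σ ^ 2 := by
          rw [Finset.mul_sum, Finset.sum_div]
          refine Finset.sum_congr rfl fun j _ => ?_
          rw [Pi.smul_apply, vecProd_wordTensor, smul_eq_mul]
          ring
      _ ≤ _ := by
          have hS := sum_wordTensor_sq_le he k₀ h u
          have hS0 : 0 ≤ ∑ j, wordTensor e k₀ h u (j, k₀) ^ 2 :=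
            Finset.sum_nonneg fun j _ => sq_nonneg _
          exact div_le_div_of_nonneg_right (mul_le_mul (hX i) hS hS0 (sq_nonneg C)) (sq_nonneg σ)
  calc _ ≤ ∑ _i : Fin n, C ^ 2 * (s * (h * R) ^ 2) / σ ^ 2 := Finset.sum_le_sum fun i _ => hrow i
    _ = _ := by
        rw [Finset.sum_const, Finset.card_univ, Fintype.card_fin, nsmul_eq_mul]
        ring

/-- The lower bound for a family of word tensors that is well separated (`hsep`), hard to tell
apart at the noise level `∏ₘ aₘ` (`hd`), and large (`hcount`). -/
theorem half_le_minimaxProb {s b R : ℕ} (hb : 0 < b) (hR : 0 < R) {e : Fin s × Fin b → Idx p}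
    (he : Function.Injective e) {k₀ : Fin q} {h C k φ d : ℝ} {X : Matrix (Fin n) (Fin q) ℝ}
    (hX : ∀ i, X i k₀ ^ 2 ≤ C ^ 2) {a : Fin M → ℝ} (ha : ∀ m, 0 < a m) {P : Set (Param p q)}
    (hP : ∀ u : Fin s → Fin b × Fin R, ⟨wordTensor e k₀ h u, fun m => a m • 1, ⊤⟩ ∈ P)
    (hk : 1 ≤ k) (hh : 0 ≤ h) (hsep : (2 * φ) ^ k ≤ s / 2 * h ^ k)
    (hd : n * C ^ 2 * (s * (h * R) ^ 2) ≤ d * ∏ m, a m)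
    (hcount : (32 * Real.exp d) ^ 2 * 4 ^ s ≤ ((b : ℝ) * R) ^ s) :
    1 / 2 ≤ minimaxProb X P k φ := by
  have : Nonempty (Fin b × Fin R) := ⟨⟨0, hb⟩, ⟨0, hR⟩⟩
  refine le_iInf fun ⟨Bhat, hBhat⟩ => ?_
  set σ : ℝ := ∏ m, √(a m) with hσ
  have hσ2 : σ ^ 2 = ∏ m, a m := by
    rw [hσ, ← Finset.prod_pow]
    exact Finset.prod_congr rfl fun m _ => Real.sq_sqrt (ha m).le
  have hprod : 0 < ∏ m, a m := Finset.prod_pos fun m _ => ha m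
  set v : (Fin s → Fin b × Fin R) → Fin n → Tensor p :=
    fun u i => σ⁻¹ • vecProd (wordTensor e k₀ h u) (X i) with hv
  have hloss : ∀ u : Fin s → Fin b × Fin R,
      Measurable fun Y => tensorNorm k (Bhat Y - wordTensor e k₀ h u) := fun u =>
    (measurable_tensorNorm k).comp (hBhat.sub_const _)
  have hdil : Measurable fun Z : Fin n → Tensor p => σ • Z := measurable_const_smul σ
  choose g hg hmap hsq using fun u => shiftBound_stdNoise (v u)
  set A : (Fin s → Fin b × Fin R) → Set (Fin n → Tensor p) :=
    fun u => {Z | tensorNorm k (Bhat (σ • Z) - wordTensor e k₀ h u) < φ} with hA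
  have hAmeas : ∀ u, MeasurableSet (A u) := fun u =>
    measurableSet_lt ((hloss u).comp hdil) measurable_const
  set N : ℝ := ((b : ℝ) * R) ^ s with hN
  have hN0 : 0 < N := by positivity
  obtain ⟨u, hu⟩ := exists_withDensity_le_half (stdNoise n p) (g := g) (d := d)
    (V := N / (32 * Real.exp d)) (A := A)
    (fun u => (hsq u).trans (ENNReal.ofReal_le_ofReal (Real.exp_le_exp.2 (by
      refine (sum_sq_shift_le he hX u).trans ?_
      rw [hσ2, div_le_iff₀ hprod]
      exact hd)))) hAmeas
    (by
      intro Z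
      rcases Set.eq_empty_or_nonempty {u | Z ∈ A u} with hempty | ⟨u₀, hu₀⟩
      · rw [hempty, Set.ncard_empty, Nat.cast_zero]
        positivity
      -- Words whose tensors are close to the same estimate lie in one Hamming ball.
      have hsub : {u | Z ∈ A u} ⊆ ((Finset.univ.filter fun u => 2 * hammingDist u u₀ ≤ s :
          Finset (Fin s → Fin b × Fin R)) : Set _) := by
        intro u hu
        rw [Finset.coe_filter]
        refine ⟨Finset.mem_univ u, hammingDist_le_of_tensorNorm_lt k₀ h hk hh hsep he ?_⟩
        have h1 : tensorNorm k (Bhat (σ • Z) - wordTensor e k₀ h u) < φ := hu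
        have h2 : tensorNorm k (Bhat (σ • Z) - wordTensor e k₀ h u₀) < φ := hu₀
        linarith [tensorNorm_sub_le hk (wordTensor e k₀ h u) (wordTensor e k₀ h u₀) (Bhat (σ • Z))]
      have hle := Set.ncard_le_ncard hsub (Finset.finite_toSet _)
      rw [Set.ncard_coe_finset] at hle
      refine (Nat.cast_le (α := ℝ).2 hle).trans ?_
      have hball := card_hammingBall_sq_le s u₀
      rw [Fintype.card_prod, Fintype.card_fin, Fintype.card_fin, Nat.cast_mul, ← hN] at hball
      refine (pow_le_pow_iff_left₀ (Nat.cast_nonneg _) (by positivity) two_ne_zero).1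
        (hball.trans ?_)
      rw [div_pow, le_div_iff₀ (by positivity), mul_right_comm, mul_comm (4 ^ s : ℝ)]
      calc _ ≤ N * N := by gcongr
        _ = N ^ 2 := (sq N).symm)
    (by
      rw [mul_div_cancel₀ _ (by positivity)]
      simp [hN, Fintype.card_pi])
  refine le_iSup₂_of_le _ (hP u) ?_
  have hprob : IsProbabilityMeasure ((stdNoise n p).withDensity (g u)) :=
    hmap u ▸ Measure.isProbabilityMeasure_map (measurable_const_add (v u)).aemeasurable
  rw [dataLaw_scalar X _ ha, ← hσ, Measure.map_apply hdil
    (measurableSet_le measurable_const (hloss u)), hmap u]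
  have hcompl : (fun Y : Fin n → Tensor p => σ • Y) ⁻¹'
      {Y | φ ≤ tensorNorm k (Bhat Y - wordTensor e k₀ h u)} = (A u)ᶜ := by
    ext Z
    simp [hA]
  rw [hcompl, prob_compl_eq_one_sub (hAmeas u)]
  calc (1 / 2 : ℝ≥0∞) = 1 - 1 / 2 := by simp
    _ ≤ _ := tsub_le_tsub_left hu 1

/-- The scalars `a_m` for which `Σ_m = a_m I`: `max 1 (c_m^*)`, multiplied by `K` in the last mode,
the only one that the identification constraint leaves free. -/
noncomputable def noiseScale (cstar : Fin M → ℝ) (K : ℝ) (m : Fin M) : ℝ :=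
  max 1 (cstar m) * if (m : ℕ) + 1 = M then K else 1

lemma le_noiseScale {cstar : Fin M → ℝ} {K : ℝ} (hK : 1 ≤ K) (m : Fin M) :
    max 1 (cstar m) ≤ noiseScale cstar K m := by
  refine le_mul_of_one_le_right (by positivity) ?_
  split_ifs
  · exact hK
  · exact le_rfl

lemma le_prod_noiseScale (hM : 1 ≤ M) (cstar : Fin M → ℝ) {K : ℝ} (hK : 1 ≤ K) :
    K ≤ ∏ m, noiseScale cstar K m := by
  have hlast : ∏ m : Fin M, (if (m : ℕ) + 1 = M then K else 1) = K := by
    rw [Finset.prod_eq_single ⟨M - 1, by omega⟩]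
    · rw [if_pos (by simp; omega)]
    · intro m _ hm
      refine if_neg fun h => hm (Fin.ext ?_)
      simp
      omega
    · simp
  have hone : (1 : ℝ) ≤ ∏ m, max 1 (cstar m) := by
    calc (1 : ℝ) = ∏ _m : Fin M, 1 := by simp
      _ ≤ _ := Finset.prod_le_prod (fun _ _ => zero_le_one) fun m _ => le_max_left _ _
  simp only [noiseScale]
  rw [Finset.prod_mul_distrib, hlast]
  exact le_mul_of_one_le_left (by linarith) hone

/-- Sparsities above the total dimension reduce to `s = p`. -/
lemma rate_le_rate_min {P s : ℕ} (hP : 1 ≤ P) (hs : 1 ≤ s) (hsP : (s : ℝ) ≤ Real.exp 1 * P) :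
    (s : ℝ) * Real.log (Real.exp 1 * P / s) ≤
        (min s P : ℕ) * Real.log (Real.exp 1 * P / (min s P : ℕ)) ∧
      (s : ℝ) ^ 2 * Real.log (Real.exp 1 * P / s) ≤
        4 * ((min s P : ℕ) ^ 2 * Real.log (Real.exp 1 * P / (min s P : ℕ))) := by
  have hP0 : (0 : ℝ) < P := by exact_mod_cast hP
  have hs0 : (0 : ℝ) < s := by exact_mod_cast hs
  have hlog : 0 ≤ Real.log (Real.exp 1 * P / s) :=
    Real.log_nonneg ((one_le_div hs0).2 hsP)
  rcases le_total s P with h | h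
  · rw [min_eq_left h]
    exact ⟨le_rfl, le_mul_of_one_le_left (by positivity) (by norm_num)⟩
  · have hup : Real.log (Real.exp 1 * P / s) ≤ P / s := by
      rw [mul_div_assoc, Real.log_mul (Real.exp_pos 1).ne' (by positivity), Real.log_exp]
      linarith [Real.log_le_sub_one_of_pos (div_pos hP0 hs0)]
    have hsl : (s : ℝ) * Real.log (Real.exp 1 * P / s) ≤ P := by
      calc _ ≤ (s : ℝ) * (P / s) := by gcongr
        _ = P := mul_div_cancel₀ _ hs0.ne'
    rw [min_eq_right h, mul_div_cancel_right₀ _ hP0.ne', Real.log_exp, mul_one]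
    refine ⟨hsl, ?_⟩
    have he : Real.exp 1 ≤ 4 := by linarith [Real.exp_one_lt_d9]
    calc (s : ℝ) ^ 2 * Real.log (Real.exp 1 * P / s)
        = s * (s * Real.log (Real.exp 1 * P / s)) := by ring
      _ ≤ (4 * P) * P := by
          gcongr
          exact hsP.trans (by gcongr)
      _ = 4 * (P ^ 2 * 1) := by ring

/-- The lower bound over any parameter set that contains every `s`-sparse coefficient tensor
together with isotropic Gaussian noise of one fixed level, which depends only on `C` and `cstar`. -/
theorem half_le_minimaxProb_of_forall_mem (hM : 1 ≤ M) (hq : 1 ≤ q) {C : ℝ} {cstar : Fin M → ℝ}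
    {s : ℕ} {X : Matrix (Fin n) (Fin q) ℝ} (hn : 1 ≤ n) (hp : ∀ m, 1 ≤ p m) (hs : 1 ≤ s)
    (hsP : (s : ℝ) ≤ Real.exp 1 * totalDim p) (hX : ∀ i, ‖WithLp.toLp 2 (X i)‖ ≤ C)
    {Q : Set (Param p q)}
    (hQ : ∀ B ∈ sparseSet p q s,
      ⟨B, fun m => noiseScale cstar (1 + 128 * C ^ 2 * 24576 ^ 2) m • 1, ⊤⟩ ∈ Q) :
    1 / 2 ≤ minimaxProb X Q 1 (phi2 n (totalDim p) s) ∧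
      1 / 2 ≤ minimaxProb X Q 2 (phi1 n (totalDim p) s) := by
  set P := totalDim p with hPdef
  have hP : 1 ≤ P := Nat.one_le_iff_ne_zero.2 (Finset.prod_ne_zero_iff.2 fun m _ =>
    (Nat.one_le_iff_ne_zero.1 (hp m)))
  obtain ⟨hrate1, hrate2⟩ := rate_le_rate_min hP hs hsP
  set t := min s P with ht
  have ht1 : 1 ≤ t := le_min hs hP
  have htP : t ≤ P := min_le_right _ _
  have ht0 : (0 : ℝ) < t := by exact_mod_cast ht1
  have hn0 : (0 : ℝ) < n := by exact_mod_cast hn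
  have hP0 : (0 : ℝ) < P := by exact_mod_cast hP
  set l := Real.log (Real.exp 1 * P / t) with hl
  have hl0 : 0 ≤ l := by
    refine Real.log_nonneg ((one_le_div ht0).2 ?_)
    have : (t : ℝ) ≤ P := by exact_mod_cast htP
    have := Real.add_one_le_exp (1 : ℝ)
    nlinarith
  have hb : 0 < P / t := Nat.div_pos htP ht1
  -- Split `t * ⌊P / t⌋` of the `P` cells into `t` blocks of equal length.
  obtain ⟨e⟩ : Nonempty (Fin t × Fin (P / t) ↪ Idx p) := by
    refine Function.Embedding.nonempty_of_card_le ?_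
    simp only [Fintype.card_prod, Fintype.card_fin, Fintype.card_pi]
    exact Nat.mul_div_le P t
  -- This multiple of `√(l / n)` separates words at Hamming distance `t / 2` for both
  -- norms.
  set h : ℝ := 8 * √(l / n) with hh
  have hh2 : h ^ 2 = 64 * (l / n) := by
    rw [hh, mul_pow, Real.sq_sqrt (by positivity)]
    norm_num
  set K : ℝ := 1 + 128 * C ^ 2 * 24576 ^ 2 with hK
  have hK1 : 1 ≤ K := by
    rw [hK]; nlinarith [sq_nonneg C]
  have hX' : ∀ i, X i ⟨0, hq⟩ ^ 2 ≤ C ^ 2 := by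
    intro i
    have := (PiLp.norm_apply_le (WithLp.toLp 2 (X i)) ⟨0, hq⟩).trans (hX i)
    rw [← sq_abs]
    exact pow_le_pow_left₀ (abs_nonneg _) this 2
  have ha : ∀ m, 0 < noiseScale cstar K m := fun m =>
    zero_lt_one.trans_le ((le_max_left _ _).trans (le_noiseScale hK1 m))
  -- As `(h * 24576) ^ 2 = 64 * 24576 ^ 2 * (l / n)`, noise variance `K` keeps the exponent of the
  -- second moment below `t * l / 2`.
  have hd : n * C ^ 2 * (t * (h * (24576 : ℕ)) ^ 2) ≤
      (t * l / 2) * ∏ m, noiseScale cstar K m := by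
    calc n * C ^ 2 * (t * (h * (24576 : ℕ)) ^ 2) = (t * l / 2) * (128 * C ^ 2 * 24576 ^ 2) := by
          rw [mul_pow, hh2]
          push_cast
          field_simp
          ring
      _ ≤ (t * l / 2) * ∏ m, noiseScale cstar K m := by
          gcongr
          exact (by rw [hK]; linarith : _ ≤ K).trans (le_prod_noiseScale hM cstar hK1)
  have hcount : (32 * Real.exp (t * l / 2)) ^ 2 * 4 ^ t ≤
      (((P / t : ℕ) : ℝ) * (24576 : ℕ)) ^ t := by
    have hexp : Real.exp (t * l / 2) ^ 2 = (Real.exp 1 * P / t) ^ t := by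
      rw [← Real.exp_nat_mul, show ((2 : ℕ) : ℝ) * (t * l / 2) = t * l by push_cast; ring,
        Real.exp_nat_mul, hl, Real.exp_log (by positivity)]
    have hdiv : (P : ℝ) / t ≤ 2 * ((P / t : ℕ) : ℝ) := by
      rw [div_le_iff₀ ht0]
      have h1 := Nat.lt_div_mul_add (a := P) ht1
      have h2 : t ≤ P / t * t := Nat.le_mul_of_pos_left t hb
      have h3 : P ≤ 2 * (P / t) * t := by linarith
      exact_mod_cast h3
    calc (32 * Real.exp (t * l / 2)) ^ 2 * 4 ^ t
        = 1024 * (Real.exp 1 * P / t) ^ t * 4 ^ t := by rw [mul_pow, hexp]; norm_num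
      _ ≤ 1024 ^ t * (Real.exp 1 * P / t) ^ t * 4 ^ t := by
          gcongr
          exact le_self_pow₀ (by norm_num) (by omega)
      _ = (4096 * Real.exp 1 * (P / t)) ^ t := by
          rw [← mul_pow, ← mul_pow]; congr 1; ring
      _ ≤ (((P / t : ℕ) : ℝ) * (24576 : ℕ)) ^ t := by
          refine pow_le_pow_left₀ (by positivity) ?_ t
          -- The number of amplitudes, `24576 = 4096 * 3 * 2`, makes the alphabet large enough here.
          have he3 : Real.exp 1 ≤ 3 := by linarith [Real.exp_one_lt_d9]
          calc 4096 * Real.exp 1 * (P / t) ≤ 4096 * 3 * (2 * ((P / t : ℕ) : ℝ)) := by gcongr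
            _ = _ := by push_cast; ring
  have hmem : ∀ u : Fin t → Fin (P / t) × Fin 24576,
      (⟨wordTensor e ⟨0, hq⟩ h u, fun m => noiseScale cstar K m • 1, ⊤⟩ : Param p q) ∈ Q :=
    fun u => hQ _ (wordTensor_mem_sparseSet _ _ (min_le_left _ _) u)
  refine ⟨half_le_minimaxProb hb (by norm_num) e.injective hX' ha hmem le_rfl (by positivity) ?_
    hd hcount, half_le_minimaxProb hb (by norm_num) e.injective hX' ha hmem one_le_two
      (by positivity) ?_ hd hcount⟩
  · rw [Real.rpow_one, Real.rpow_one]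
    have : phi2 n P s ≤ 2 * (t * √(l / n)) := by
      refine (pow_le_pow_iff_left₀ (by unfold phi2; positivity) (by positivity) two_ne_zero).1 ?_
      have hlog : 0 ≤ Real.log (Real.exp 1 * P / s) :=
        Real.log_nonneg ((one_le_div (by exact_mod_cast hs)).2 hsP)
      rw [phi2, mul_pow, Real.sq_sqrt (by positivity), mul_pow, mul_pow,
        Real.sq_sqrt (by positivity)]
      have := div_le_div_of_nonneg_right hrate2 hn0.le
      calc _ = (s : ℝ) ^ 2 * Real.log (Real.exp 1 * P / s) / n := by ring
        _ ≤ 4 * (t ^ 2 * l) / n := this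
        _ = _ := by ring
    rw [hh]
    linarith
  · rw [Real.rpow_two, Real.rpow_two, hh2, mul_pow, phi1]
    have hlog : 0 ≤ Real.log (Real.exp 1 * P / s) :=
      Real.log_nonneg ((one_le_div (by exact_mod_cast hs)).2 hsP)
    rw [Real.sq_sqrt (by positivity)]
    have := div_le_div_of_nonneg_right hrate1 hn0.le
    have h0 : 0 ≤ (t : ℝ) * l / n := by positivity
    calc _ ≤ (2 : ℝ) ^ 2 * (t * l / n) := by gcongr
      _ ≤ 32 * (t * l / n) := by linarith
      _ = _ := by ring

end TensorReg

theorem mainTheorem3 (M q : ℕ) (hM : 1 ≤ M) (hq : 1 ≤ q) (c C : ℝ) (hc : 0 < c)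
    (cstar : Fin M → ℝ) (hcstar : ∀ m, 0 < cstar m) :
    ∃ cbar : ℝ, 0 < cbar ∧
      ∀ (n : ℕ) (p : Fin M → ℕ) (s : ℕ) (X : Matrix (Fin n) (Fin q) ℝ),
        1 ≤ n → (∀ m, 1 ≤ p m) → 1 ≤ s →
        (s : ℝ) ≤ Real.exp 1 * (TensorReg.totalDim p : ℝ) →
        TensorReg.DesignCondition X c C →
        (ENNReal.ofReal cbar ≤ TensorReg.minimaxProb X (TensorReg.paramSpace p q s cstar) 1
            (TensorReg.phi2 n (TensorReg.totalDim p) s) ∧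
          ENNReal.ofReal cbar ≤ TensorReg.minimaxProb X (TensorReg.paramSpace p q s cstar) 2
            (TensorReg.phi1 n (TensorReg.totalDim p) s)) ∧
        ((∀ m : Fin M, (m : ℕ) + 1 < M → cstar m ≤ 1) →
          ENNReal.ofReal cbar ≤ TensorReg.minimaxProb X
              (TensorReg.paramSpace p q s cstar ∩ TensorReg.identified p q) 1
              (TensorReg.phi2 n (TensorReg.totalDim p) s) ∧
            ENNReal.ofReal cbar ≤ TensorReg.minimaxProb X
              (TensorReg.paramSpace p q s cstar ∩ TensorReg.identified p q) 2
              (TensorReg.phi1 n (TensorReg.totalDim p) s)) := by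
  refine ⟨1 / 2, by norm_num, fun n p s X hn hp hs hsP hX => ?_⟩
  have hhalf : ENNReal.ofReal (1 / 2) = 1 / 2 := by
    rw [ENNReal.ofReal_div_of_pos two_pos]
    simp
  rw [hhalf]
  have hK : (1 : ℝ) ≤ 1 + 128 * C ^ 2 * 24576 ^ 2 := by nlinarith [sq_nonneg C]
  have hmem : ∀ B ∈ TensorReg.sparseSet p q s,
      (⟨B, fun m => TensorReg.noiseScale cstar (1 + 128 * C ^ 2 * 24576 ^ 2) m • 1, ⊤⟩ :
        TensorReg.Param p q) ∈ TensorReg.paramSpace p q s cstar := by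
    refine fun B hB => ⟨hB, fun m => ?_, by simp⟩
    have hle := TensorReg.le_noiseScale (cstar := cstar) hK m
    exact TensorReg.smul_one_mem_wellCond (zero_lt_one.trans_le ((le_max_left _ _).trans hle))
      ((le_max_right _ _).trans hle)
  refine ⟨TensorReg.half_le_minimaxProb_of_forall_mem hM hq hn hp hs hsP hX.2 hmem, fun hcs => ?_⟩
  refine TensorReg.half_le_minimaxProb_of_forall_mem hM hq hn hp hs hsP hX.2
    fun B hB => ⟨hmem B hB, fun m hm i _ => ?_⟩
  simp [TensorReg.noiseScale, hcs m hm, hm.ne]
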